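/- Let $Q$ be a smooth manifold of dimension $n$ with local coordinates $(q^i)$, and let $k$ be a natural number. Let $T^1_kQ=TQ\oplus\cdots\oplus TQ$ and $(T^1_k)^*Q=T^*Q\oplus\cdots\oplus T^*Q$ be the Whitney sums of $k$ copies, with induced coordinates $(q^i,v^i_A)$ and $(q^i,p^A_i)$, $1\le A\le k$, and let $\tau_Q\colon T^1_kQ\to Q$ be the projection. On $T^1_kQ$ let $S^1,\dots,S^k$ be the canonical $k$-tangent structure, $S^A(p)(W)=\frac{d}{ds}\big|_{s=0}(v_1,\dots,v_A+s\,(\tau_Q)_*W,\dots,v_k)$ for $p=(v_1,\dots,v_k)$, $W\in T_p(T^1_kQ)$, and let $C$ be the Liouville vector field, the generator of $(s,(v_1,\dots,v_k))\mapsto(e^sv_1,\dots,e^sv_k)$. For a smooth Lagrangian $L\colon T^1_kQ\to\mathbb R$ put $(\theta_L)_A=dL\circ S^A$, $(\omega_L)_A=-d(\theta_L)_A$, $E_L=C(L)-L$. The Legendre map $FL\colon T^1_kQ\to(T^1_k)^*Q$ is $[FL(v_1,\dots,v_k)]^A(w)=\frac{d}{ds}\big|_{s=0}L(v_1,\dots,v_A+sw,\dots,v_k)$.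 $L$ is regular if the matrix $\big(\partial^2L/\partial v^i_A\partial v^j_B\big)$ is invertible at every point. On $(T^1_k)^*Q$ let $(\omega_0)_A=-d(\theta_0)_A$, where $(\theta_0)_A=p^A_i\,dq^i$ is the pull-back of the Liouville form of $T^*Q$ by the projection on the $A$-th copy. On $T^1_kQ\oplus_Q(T^1_k)^*Q$, with projections $pr_1,pr_2$, put $\Omega_A=pr_2^*(\omega_0)_A$ and $\mathcal H(v_1,\dots,v_k,\alpha^1,\dots,\alpha^k)=\sum_A\alpha^A(v_A)-L(v_1,\dots,v_k)$, and let $M_L=\{w: pr_2(w)=FL(pr_1(w))\}$ be the graph of $FL$, the image of the injective map $Id\oplus FL\colon T^1_kQ\to T^1_kQ\oplus_Q(T^1_k)^*Q$. An integral section of a $k$-vector field $(Y_1,\dots,Y_k)$ is a smooth map $\varphi$ defined on an open neighbourhood $U$ of $0\in\mathbb R^k$ with $\varphi_*(t)(\partial/\partial t^A)=Y_A(\varphi(t))$ for all $t\in U$ and all $A$. **Proposition.** Let $L$ be regular and let $X=(X_1,\dots,X_k)$ be a smooth $k$-vector field on $T^1_kQ$ that is a solution of $$\sum_{A=1}^k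 i_{X_A}(\omega_L)_A=dE_L .$$ 1. The $k$-vector field $Z=(Z_1,\dots,Z_k)$ along $M_L$ given by $Z_A=(Id\oplus FL)_*(X_A)$ is smooth, at every point of $M_L$ it satisfies $$\sum_{A=1}^k i_{Z_A}\Omega_A=d\mathcal H$$ (as an equality of covectors of $T^1_kQ\oplus_Q(T^1_k)^*Q$), and each $Z_A$ is tangent to $M_L$. 2. Let $\psi_L\colon U\to T^1_kQ$, with $U$ an open neighbourhood of $0$ in $\mathbb R^k$ (for instance $U=\mathbb R^k$), be an integral section of $X$. Then $\psi_L$ is the first prolongation $\phi^{(1)}=(\partial\phi/\partial t^1,\dots,\partial\phi/\partial t^k)$ of $\phi=\tau_Q\circ\psi_L$, and $\phi$ is a solution on $U$ of the Euler–Lagrange field equations $$\sum_{A=1}^k\frac{\partial}{\partial t^A}\Big(\frac{\partial L}{\partial v^i_A}\circ\phi^{(1)}\Big)=\frac{\partial L}{\partial q^i}\circ\phi^{(1)},\qquad 1\le i\le n .$$ Moreover $\psi=(\psi_L,FL\circ\psi_L)$ takes values in $M_L$ and is an integral section of $Z$. -/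

import Mathlib

open Bundle Set
open scoped Manifold ContDiff Topology

noncomputable section

namespace KSymplectic

/-! ### Differential forms, vector fields and their operations on a manifold without boundary -/

section General

variable {E H M : Type*} [NormedAddCommGroup E] [NormedSpace ℝ E] [TopologicalSpace H]
  (I : ModelWithCorners ℝ E H) [TopologicalSpace M] [ChartedSpace H M]
  {E' H' N : Type*} [NormedAddCommGroup E'] [NormedSpace ℝ E'] [TopologicalSpace H']
  (I' : ModelWithCorners ℝ E' H') [TopologicalSpace N] [ChartedSpace H' N]

/-- Differential 1-forms on `M` (no regularity). -/
abbrev OneForm (M : Type*) [TopologicalSpace M] [ChartedSpace H M] : Type _ :=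
  (x : M) → TangentSpace I x →L[ℝ] ℝ

/-- Fields of bilinear forms on `M`; differential 2-forms are among these. -/
abbrev TwoForm (M : Type*) [TopologicalSpace M] [ChartedSpace H M] : Type _ :=
  (x : M) → TangentSpace I x →ₗ[ℝ] TangentSpace I x →ₗ[ℝ] ℝ

/-- The differential `df` of a function. -/
def dFun (f : M → ℝ) : OneForm I M := fun x => mfderiv I 𝓘(ℝ, ℝ) f x

/-- The expression of a 1-form in the chart around `x₀`, i.e. its pull-back by the inverse of
that chart, as a function on the model space with values in the dual of the model space. -/
def OneForm.inChart (θ : OneForm I M) (x₀ : M) (y : E) : E →L[ℝ] ℝ :=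
  (θ ((extChartAt I x₀).symm y)).comp (mfderiv 𝓘(ℝ, E) I (extChartAt I x₀).symm y)

/-- The exterior derivative of a 1-form: in a chart around `x`,
`dθ(u, w) = D_u (θ(w)) - D_w (θ(u))` for constant `u`, `w`. -/
def OneForm.d (θ : OneForm I M) : TwoForm I M := fun x =>
  let D : E →L[ℝ] E →L[ℝ] ℝ := fderiv ℝ (OneForm.inChart I θ x) (extChartAt I x x)
  let T : TangentSpace I x →L[ℝ] E := mfderiv I 𝓘(ℝ, E) (extChartAt I x) x
  LinearMap.mk₂ ℝ (fun u w => D (T u) (T w) - D (T w) (T u))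
    (fun a b c => by simp only [map_add, add_apply]; ring)
    (fun a b c => by simp only [map_smul, smul_apply, smul_eq_mul]; ring)
    (fun a b c => by simp only [map_add, add_apply]; ring)
    (fun a b c => by simp only [map_smul, smul_apply, smul_eq_mul]; ring)

/-- The pull-back of a 2-form by a map. -/
def TwoForm.pullback (f : M → N) (σ : TwoForm I' N) : TwoForm I M := fun x =>
  (σ (f x)).compl₁₂ (mfderiv I I' f x).toLinearMap (mfderiv I I' f x).toLinearMap

/-- The equation `∑_A i_{Z_A} σ_A = α` between covectors at the point `x`. -/
def FieldEqAt {k : ℕ} (σ : Fin k → TwoForm I M) (α : OneForm I M)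
    (Z : Fin k → (x : M) → TangentSpace I x) (x : M) : Prop :=
  ∀ W : TangentSpace I x, ∑ A, σ A x (Z A x) W = α x W

open Classical in
/-- The push-forward `f_* X` of a vector field `X` on `M` by an injective map `f : M → N`, a vector
field along `f(M)`: its value at `f x` is `f_*(x)(X x)`. (Outside `f(M)` it is set to `0`.) -/
def pushforward (f : M → N) (X : (x : M) → TangentSpace I x) (y : N) : TangentSpace I' y :=
  if h : ∃ x, f x = y then h.choose_spec ▸ mfderiv I I' f h.choose (X h.choose) else 0

theorem pushforward_apply {f : M → N} (hf : Function.Injective f)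
    (X : (x : M) → TangentSpace I x) (x : M) :
    pushforward I I' f X (f x) = mfderiv I I' f x (X x) := by
  have h : ∃ x', f x' = f x := ⟨x, rfl⟩
  unfold pushforward
  rw [dif_pos h]
  have key : ∀ (x' : M) (e : f x' = f x),
      (e ▸ mfderiv I I' f x' (X x') : TangentSpace I' (f x)) = mfderiv I I' f x (X x) := by
    intro x' e
    obtain rfl : x' = x := hf e
    rfl
  exact key _ _

/-- A family of vector fields, defined along the subset `S`, is smooth on `S`. -/
def SmoothOn {k : ℕ} [IsManifold I 1 M] (Z : Fin k → (x : M) → TangentSpace I x) (S : Set M) :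
    Prop :=
  ∀ A, ContMDiffOn I I.tangent ∞ (fun x => (⟨x, Z A x⟩ : TangentBundle I M)) S

/-- The velocity vector of a curve at the parameter `s`. -/
def velocity (c : ℝ → M) (s : ℝ) : TangentSpace I (c s) :=
  mfderiv 𝓘(ℝ, ℝ) I c s (1 : ℝ)

/-- The tangent vector `u` at `x` is tangent to the subset `S`: it is the velocity at time `0` of
a curve that is smooth around `0` and stays in `S`. (For an embedded submanifold `S` and `x ∈ S`
these are exactly the vectors in `T_x S`.) -/
def IsTangentTo (S : Set M) (x : M) (u : TangentSpace I x) : Prop :=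
  ∃ c : ℝ → M, ContMDiffAt 𝓘(ℝ, ℝ) I ∞ c 0 ∧ (∀ᶠ s in 𝓝 (0 : ℝ), c s ∈ S) ∧
    (⟨c 0, velocity I c 0⟩ : TangentBundle I M) = ⟨x, u⟩

/-- `φ : U → M` is an integral section of the `k`-vector field `(Z_1, …, Z_k)`, where `U` is an
open neighbourhood of `0` in `ℝ^k`. It passes through the point `φ 0`. -/
structure IsIntegralSection {k : ℕ} (Z : Fin k → (x : M) → TangentSpace I x)
    (U : Set (Fin k → ℝ)) (φ : (Fin k → ℝ) → M) : Prop where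
  isOpen : IsOpen U
  zero_mem : (0 : Fin k → ℝ) ∈ U
  smooth : ContMDiffOn 𝓘(ℝ, Fin k → ℝ) I ∞ φ U
  eq : ∀ t ∈ U, ∀ A : Fin k,
    mfderiv 𝓘(ℝ, Fin k → ℝ) I φ t (Pi.single A (1 : ℝ) : Fin k → ℝ) = Z A (φ t)

end General

/-! ### The bundles `T¹ₖQ`, `(T¹ₖ)*Q` and their Whitney sum -/

section Bundles

/-- The model space of `Q`. -/
abbrev Eu (n : ℕ) : Type := EuclideanSpace ℝ (Fin n)

/-- The model fibre of `T¹ₖQ`. -/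
abbrev FVel (n k : ℕ) : Type := (Fin k → ℝ) →L[ℝ] Eu n

/-- The model fibre of `(T¹ₖ)*Q`. -/
abbrev FCov (n k : ℕ) : Type := Eu n →L[ℝ] (Fin k → ℝ)

variable (n k : ℕ) (Q : Type*) [TopologicalSpace Q] [ChartedSpace (Eu n) Q]
  [IsManifold (𝓡 n) ∞ Q]

/-- `T¹ₖQ = TQ ⊕ ⋯ ⊕ TQ`: its fibre over `q` consists of the linear maps `v : ℝ^k → T_q Q`
(the 1-jets at `0` of maps `σ : ℝ^k → Q` with `σ 0 = q`), i.e. of the `k`-tuples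
`(v_1, …, v_k)` with `v_A = v e_A ∈ T_q Q`. -/
abbrev Vel : Type _ :=
  TotalSpace (FVel n k) (fun q : Q => Trivial Q (Fin k → ℝ) q →L[ℝ] TangentSpace (𝓡 n) q)

/-- `(T¹ₖ)*Q = T*Q ⊕ ⋯ ⊕ T*Q`: its fibre over `q` consists of the linear maps
`α : T_q Q → ℝ^k` (the 1-jets at `q` of maps `Q → ℝ^k` with value `0` at `q`), i.e. of the
`k`-tuples `(α^1, …, α^k)` of covectors with `α^A w = (α w)_A`. -/
abbrev Cov : Type _ :=
  TotalSpace (FCov n k) (fun q : Q => TangentSpace (𝓡 n) q →L[ℝ] Trivial Q (Fin k → ℝ) q)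

/-- The Whitney sum `T¹ₖQ ⊕_Q (T¹ₖ)*Q`. -/
abbrev Uni : Type _ :=
  TotalSpace (FVel n k × FCov n k)
    ((fun q : Q => Trivial Q (Fin k → ℝ) q →L[ℝ] TangentSpace (𝓡 n) q) ×ᵇ
      (fun q : Q => TangentSpace (𝓡 n) q →L[ℝ] Trivial Q (Fin k → ℝ) q))

/-- The model with corners of `T¹ₖQ`. -/
abbrev IVel := (𝓡 n).prod 𝓘(ℝ, FVel n k)

/-- The model with corners of `(T¹ₖ)*Q`. -/
abbrev ICov := (𝓡 n).prod 𝓘(ℝ, FCov n k)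

/-- The model with corners of `T¹ₖQ ⊕_Q (T¹ₖ)*Q`. -/
abbrev IUni := (𝓡 n).prod 𝓘(ℝ, FVel n k × FCov n k)

end Bundles

section Structures

variable {n k : ℕ} {Q : Type*} [TopologicalSpace Q] [ChartedSpace (Eu n) Q]
  [IsManifold (𝓡 n) ∞ Q]

/-! ### The canonical structures of `T¹ₖQ` -/

/-- The linear map `X ↦ (0, …, X, …, 0)`, with `X` in the place `A`. -/
def insertAt (A : Fin k) : Eu n →L[ℝ] FVel n k :=
  ContinuousLinearMap.smulRightL ℝ (Fin k → ℝ) (Eu n) (ContinuousLinearMap.proj A)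

/-- The inclusion of the fibre over `q` into `T¹ₖQ`. -/
def fibreIncl (q : Q) (v : FVel n k) : Vel n k Q := ⟨q, v⟩

/-- The vertical `A`-lift of tangent vectors `X` of `Q` at `q = τ_Q p` to `T_p(T¹ₖQ)`, i.e.
the derivative at `s = 0` of `s ↦ (v_1, …, v_A + s X, …, v_k)` for `p = (v_1, …, v_k)`. -/
def vertLift (A : Fin k) (p : Vel n k Q) :
    TangentSpace (𝓡 n) p.proj →L[ℝ] TangentSpace (IVel n k) p :=
  let D : FVel n k →L[ℝ] TangentSpace (IVel n k) p :=
    mfderiv 𝓘(ℝ, FVel n k) (IVel n k) (fibreIncl (n := n) (k := k) p.proj) p.snd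
  D.comp (insertAt A)

/-- The canonical `k`-tangent structure `(S^1, …, S^k)`: `S^A(p)(W) = ((τ_Q)_* W)^A`. -/
def kTangent (A : Fin k) (p : Vel n k Q) :
    TangentSpace (IVel n k) p →L[ℝ] TangentSpace (IVel n k) p :=
  (vertLift A p).comp (mfderiv (IVel n k) (𝓡 n) TotalSpace.proj p)

/-! ### Lagrangian objects -/

/-- `(θ_L)_A = dL ∘ S^A`. -/
def thetaL (L : Vel n k Q → ℝ) (A : Fin k) : OneForm (IVel n k) (Vel n k Q) := fun p =>
  (dFun (IVel n k) L p).comp (kTangent A p)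

/-- `(ω_L)_A = -d(θ_L)_A`. -/
def omegaL (L : Vel n k Q → ℝ) (A : Fin k) : TwoForm (IVel n k) (Vel n k Q) :=
  fun p => -OneForm.d (IVel n k) (thetaL L A) p

/-- The energy `E_L = C(L) - L`; the Liouville vector field `C` generates the flow
`(s, (v_1, …, v_k)) ↦ (e^s v_1, …, e^s v_k)`. -/
def energy (L : Vel n k Q → ℝ) (p : Vel n k Q) : ℝ :=
  deriv (fun s : ℝ => L ⟨p.proj, Real.exp s • p.snd⟩) 0 - L p

/-- The Legendre map `FL : T¹ₖQ → (T¹ₖ)*Q`,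
`[FL(v_1, …, v_k)]^A(w) = d/ds L(v_1, …, v_A + s w, …, v_k)` at `s = 0`. -/
def legendre (L : Vel n k Q → ℝ) (p : Vel n k Q) : Cov n k Q :=
  ⟨p.proj, ContinuousLinearMap.pi fun A : Fin k =>
    (fderiv ℝ (fun v : FVel n k => L (fibreIncl p.proj v)) p.snd).comp (insertAt A)⟩

/-- The Lagrangian as a function of the coordinates `(q^i, v^i_A)` induced on `T¹ₖQ` by the
chart of `Q` around `τ_Q p`. -/
def lagInChart (L : Vel n k Q → ℝ) (p : Vel n k Q) (y : Eu n × FVel n k) : ℝ :=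
  L ((extChartAt (IVel n k) p).symm y)

/-- The coordinate direction `∂/∂q^i`. -/
def dirQ (k : ℕ) (i : Fin n) : Eu n × FVel n k := (EuclideanSpace.single i 1, 0)

/-- The coordinate direction `∂/∂v^i_A`. -/
def dirV (i : Fin n) (A : Fin k) : Eu n × FVel n k :=
  (0, insertAt A (EuclideanSpace.single i 1))

/-- `L` is regular: the matrix `(∂²L/∂v^i_A ∂v^j_B)`, of size `nk × nk`, is invertible at every
point, in induced coordinates around this point (the choice of the coordinates is immaterial). -/
def IsRegularLagrangian (L : Vel n k Q → ℝ) : Prop :=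
  ∀ p : Vel n k Q,
    (Matrix.of fun a b : Fin n × Fin k =>
      fderiv ℝ (fun y => fderiv ℝ (lagInChart L p) y (dirV b.1 b.2))
        (extChartAt (IVel n k) p p) (dirV a.1 a.2)).det ≠ 0

/-- The first prolongation `φ^{(1)}` of a map `φ` from (an open subset of) `ℝ^k` to `Q`, with
value at `t` the `k`-tuple of the partial derivatives `∂φ/∂t^A` at `t`. -/
def prolong (φ : (Fin k → ℝ) → Q) (t : Fin k → ℝ) : Vel n k Q :=
  ⟨φ t, mfderiv 𝓘(ℝ, Fin k → ℝ) (𝓡 n) φ t⟩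

/-- `φ` is a solution of the Euler-Lagrange field equations
`∑_A ∂/∂t^A (∂L/∂v^i_A ∘ φ^{(1)}) = ∂L/∂q^i ∘ φ^{(1)}` on `U`; at each `t` they are written in
induced coordinates around `φ^{(1)}(t)` (the choice of the coordinates is immaterial). -/
structure IsEulerLagrangeSol (L : Vel n k Q → ℝ) (U : Set (Fin k → ℝ))
    (φ : (Fin k → ℝ) → Q) : Prop where
  smooth : ContMDiffOn 𝓘(ℝ, Fin k → ℝ) (𝓡 n) ∞ φ U
  eq : ∀ t ∈ U, ∀ i : Fin n,
    let p : Vel n k Q := prolong φ t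
    ∑ A : Fin k, fderiv ℝ (fun s : Fin k → ℝ =>
        fderiv ℝ (lagInChart L p)
          (extChartAt (IVel n k) p (prolong φ s : Vel n k Q)) (dirV i A)) t (Pi.single A 1) =
      fderiv ℝ (lagInChart L p) (extChartAt (IVel n k) p p) (dirQ k i)

/-! ### The canonical structure of `(T¹ₖ)*Q` and the unified formalism -/

/-- The pull-back `(θ_0)_A` of the Liouville form of `T*Q` by the projection on the `A`-th copy:
`(θ_0)_A(α)(W) = α^A((τ*_Q)_* W)`. -/
def theta0 (A : Fin k) : OneForm (ICov n k) (Cov n k Q) := fun α =>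
  ((ContinuousLinearMap.proj A : (Fin k → ℝ) →L[ℝ] ℝ).comp α.snd).comp
    (mfderiv (ICov n k) (𝓡 n) TotalSpace.proj α)

/-- The canonical polysymplectic structure `(ω_0)_A = -d(θ_0)_A`. -/
def omega0 (A : Fin k) : TwoForm (ICov n k) (Cov n k Q) :=
  fun α => -OneForm.d (ICov n k) (theta0 A) α

/-- The projection of the Whitney sum to `T¹ₖQ`. -/
def pr1 (w : Uni n k Q) : Vel n k Q := ⟨w.proj, w.snd.1⟩

/-- The projection of the Whitney sum to `(T¹ₖ)*Q`. -/
def pr2 (w : Uni n k Q) : Cov n k Q := ⟨w.proj, w.snd.2⟩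

/-- `Ω_A = pr_2^* (ω_0)_A`. -/
def Omega (A : Fin k) : TwoForm (IUni n k) (Uni n k Q) :=
  TwoForm.pullback (IUni n k) (ICov n k) pr2 (omega0 A)

/-- The coupling function `∑_A α^A(v_A)`. -/
def coupling (w : Uni n k Q) : ℝ :=
  ∑ A : Fin k, (w.snd.2 (w.snd.1 (Pi.single A 1 : Fin k → ℝ)) : Fin k → ℝ) A

/-- The Hamiltonian function `𝓗 = 𝓒 - pr_1^* L` of the unified formalism. -/
def hamiltonian (L : Vel n k Q → ℝ) (w : Uni n k Q) : ℝ := coupling w - L (pr1 w)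

/-- The map `Id ⊕ FL : T¹ₖQ → T¹ₖQ ⊕_Q (T¹ₖ)*Q`. -/
def idSumFL (L : Vel n k Q → ℝ) (p : Vel n k Q) : Uni n k Q :=
  ⟨p.proj, (p.snd, (legendre L p).snd)⟩

/-- The graph `M_L` of the Legendre map. -/
def ML (L : Vel n k Q → ℝ) : Set (Uni n k Q) := {w | pr2 w = legendre L (pr1 w)}

end Structures

end KSymplectic

end

/-!
The statement reduces to a computation at one point. A tangent space of a manifold is here the model
space, identified through the preferred chart at the point, so the derivative of a map at a point,
and the exterior derivative of a form there, are ordinary derivatives of expressions in the preferred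
charts (`mfderiv_eq_of_writtenInExtChartAt`, `oneForm_d_apply`). For the bundles involved these
charts are the induced coordinates `(q, v, p)`. The exterior derivatives need the coordinate
expressions of `θ_L` and `θ_0` also at nearby points; these come from `thetaL_apply`,
`legendre_comp_tangentCoordSymm` and `mfderiv_proj_extChartAt_symm`.

Write `μ = ∂L/∂v` for the coordinate expression of the Legendre map (`momentum`). At a point,
`ω_L^A(U, W)` is `(Dμ(W)(U_q) - Dμ(U)(W_q))^A` and `dE_L(W)` is `∑_A Dμ(W)(v_A)^A - ∂_q L(W_q)`.
On vertical `W` the field equation says that the vertical Hessian annihilates the vectors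
`(X_A)_q - v_A`; since `L` is regular, `(X_A)_q = v_A`. On horizontal `W` it then becomes
`∑_A Dμ(X_A)^A = ∂_q L`. This is `secondOrder_and_eulerLagrange_of_fieldEq`, from which the rest
follows:

* At a point of the graph of `FL` the terms of `d𝓗` in `dv` cancel, and `Z_A = (v_A, ∗, Dμ(X_A))`,
  so both sides of the unified equation agree (`fieldEqAt_Omega`). Smoothness and tangency of `Z`
  hold because `Id ⊕ FL` is smooth with left inverse `pr₁` and image the graph.
* For an integral section `ψ` of `X`, the first identity says that `ψ` is the prolongation of its
  projection, and the second one, by the chain rule, is the Euler-Lagrange equation.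
-/

noncomputable section

namespace KSymplectic

/-! ### Induced coordinates on the bundles -/

section Coordinates

variable {n k : ℕ} {Q : Type*} [TopologicalSpace Q] [ChartedSpace (Eu n) Q]
  [IsManifold (𝓡 n) ∞ Q]

/-- The coordinates of tangent vectors at `q` in the chart of `Q` around `q₀`. The tangent space at
`q` is written as its model `ℝ^n`; the map is `0` if `q` is outside the domain of the chart. -/
def tangentCoord (q₀ q : Q) : Eu n →L[ℝ] Eu n :=
  (trivializationAt (Eu n) (TangentSpace (𝓡 n)) q₀).continuousLinearMapAt ℝ q

/-- The tangent vector at `q` with given coordinates in the chart of `Q` around `q₀`, inverse to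
`tangentCoord` if `q` is in the domain of the chart. -/
def tangentCoordSymm (q₀ q : Q) : Eu n →L[ℝ] Eu n :=
  (trivializationAt (Eu n) (TangentSpace (𝓡 n)) q₀).symmL ℝ q

theorem tangentCoord_symm {q₀ q : Q} (hq : q ∈ (extChartAt (𝓡 n) q₀).source) (w : Eu n) :
    tangentCoord q₀ q (tangentCoordSymm q₀ q w) = w :=
  Trivialization.continuousLinearMapAt_symmL _ (by simpa using hq) w

theorem tangentCoordSymm_coord {q₀ q : Q} (hq : q ∈ (extChartAt (𝓡 n) q₀).source)
    (w : Eu n) :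
    tangentCoordSymm q₀ q (tangentCoord q₀ q w) = w :=
  (trivializationAt (Eu n) (TangentSpace (𝓡 n)) q₀).symmL_continuousLinearMapAt (R := ℝ)
    (by simpa using hq) w

theorem trivializationAt_vel (q₀ : Q) (p : Vel n k Q) :
    trivializationAt (FVel n k)
      (fun q : Q => Trivial Q (Fin k → ℝ) q →L[ℝ] TangentSpace (𝓡 n) q) q₀ p =
      (p.proj, (tangentCoord q₀ p.proj).comp p.snd) := by
  rw [hom_trivializationAt_apply]
  have h : (trivializationAt (Fin k → ℝ) (Trivial Q (Fin k → ℝ)) q₀).symmL ℝ p.proj =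
    ContinuousLinearMap.id ℝ _ := Trivial.symmL_trivialization ℝ Q _ _
  simp only [ContinuousLinearMap.inCoordinates]
  rw [h]
  rfl

theorem trivializationAt_cov (q₀ : Q) (p : Cov n k Q) :
    trivializationAt (FCov n k)
      (fun q : Q => TangentSpace (𝓡 n) q →L[ℝ] Trivial Q (Fin k → ℝ) q) q₀ p =
      (p.proj, ContinuousLinearMap.comp p.snd (tangentCoordSymm q₀ p.proj)) := by
  rw [hom_trivializationAt_apply]
  have h : (trivializationAt (Fin k → ℝ) (Trivial Q (Fin k → ℝ)) q₀).continuousLinearMapAt ℝ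
    p.proj = ContinuousLinearMap.id ℝ _ := Trivial.continuousLinearMapAt_trivialization ℝ Q _ _
  simp only [ContinuousLinearMap.inCoordinates]
  rw [h]
  rfl

theorem trivializationAt_uni (q₀ : Q) (w : Uni n k Q) :
    trivializationAt (FVel n k × FCov n k)
      ((fun q : Q => Trivial Q (Fin k → ℝ) q →L[ℝ] TangentSpace (𝓡 n) q) ×ᵇ
        (fun q : Q => TangentSpace (𝓡 n) q →L[ℝ] Trivial Q (Fin k → ℝ) q)) q₀ w =
      (w.proj, ((tangentCoord q₀ w.proj).comp w.snd.1,
        ContinuousLinearMap.comp w.snd.2 (tangentCoordSymm q₀ w.proj))) :=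
  congrArg₂ (fun (a : Q × FVel n k) (b : Q × FCov n k) => (w.proj, (a.2, b.2)))
    (trivializationAt_vel q₀ (pr1 w)) (trivializationAt_cov q₀ (pr2 w))

/-- The charts of `T¹ₖQ` are the induced coordinates `(q^i, v^i_A)`. -/
theorem extChartAt_vel (p₀ p : Vel n k Q) :
    extChartAt (IVel n k) p₀ p =
      (extChartAt (𝓡 n) p₀.proj p.proj, (tangentCoord p₀.proj p.proj).comp p.snd) := by
  rw [FiberBundle.extChartAt]
  exact congrArg (fun z : Q × FVel n k => (extChartAt (𝓡 n) p₀.proj z.1, z.2))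
    (trivializationAt_vel p₀.proj p)

/-- The charts of `(T¹ₖ)*Q` are the induced coordinates `(q^i, p^A_i)`. -/
theorem extChartAt_cov (p₀ p : Cov n k Q) :
    extChartAt (ICov n k) p₀ p =
      (extChartAt (𝓡 n) p₀.proj p.proj,
        ContinuousLinearMap.comp p.snd (tangentCoordSymm p₀.proj p.proj)) := by
  rw [FiberBundle.extChartAt]
  exact congrArg (fun z : Q × FCov n k => (extChartAt (𝓡 n) p₀.proj z.1, z.2))
    (trivializationAt_cov p₀.proj p)

/-- The charts of the Whitney sum are the induced coordinates `(q^i, v^i_A, p^A_i)`. -/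
theorem extChartAt_uni (w₀ w : Uni n k Q) :
    extChartAt (IUni n k) w₀ w =
      (extChartAt (𝓡 n) w₀.proj w.proj, ((tangentCoord w₀.proj w.proj).comp w.snd.1,
        ContinuousLinearMap.comp w.snd.2 (tangentCoordSymm w₀.proj w.proj))) := by
  rw [FiberBundle.extChartAt]
  exact congrArg (fun z : Q × (FVel n k × FCov n k) => (extChartAt (𝓡 n) w₀.proj z.1, z.2))
    (trivializationAt_uni w₀.proj w)

theorem mem_extChartAt_source_vel {p₀ p : Vel n k Q} :
    p ∈ (extChartAt (IVel n k) p₀).source ↔ p.proj ∈ (extChartAt (𝓡 n) p₀.proj).source := by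
  rw [FiberBundle.extChartAt]
  simp only [mfld_simps, trivializationAt_vel]
  tauto

theorem mem_extChartAt_source_uni {p₀ p : Uni n k Q} :
    p ∈ (extChartAt (IUni n k) p₀).source ↔ p.proj ∈ (extChartAt (𝓡 n) p₀.proj).source := by
  rw [FiberBundle.extChartAt]
  simp only [mfld_simps, trivializationAt_uni]
  simp

theorem contMDiff_pr1 : ContMDiff (IUni n k) (IVel n k) ∞ (pr1 : Uni n k Q → Vel n k Q) := by
  intro w
  have h := contMDiffAt_totalSpace.1
    (contMDiffAt_id (I := IUni n k) (n := ∞) (x := w))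
  refine contMDiffAt_totalSpace.2 ⟨h.1, ?_⟩
  simp only [trivializationAt_vel]
  simp only [trivializationAt_uni] at h
  exact (contDiff_fst (n := ∞)).contMDiff.contMDiffAt.comp w h.2

theorem contMDiff_pr2 : ContMDiff (IUni n k) (ICov n k) ∞ (pr2 : Uni n k Q → Cov n k Q) := by
  intro w
  have h := contMDiffAt_totalSpace.1
    (contMDiffAt_id (I := IUni n k) (n := ∞) (x := w))
  refine contMDiffAt_totalSpace.2 ⟨h.1, ?_⟩
  simp only [trivializationAt_cov]
  simp only [trivializationAt_uni] at h
  exact (contDiff_snd (n := ∞)).contMDiff.contMDiffAt.comp w h.2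

theorem contMDiff_fibreIncl (q : Q) :
    ContMDiff 𝓘(ℝ, FVel n k) (IVel n k) ∞ (fibreIncl (n := n) (k := k) q) := by
  intro v
  refine contMDiffAt_totalSpace.2 ⟨contMDiffAt_const, ?_⟩
  simp only [trivializationAt_vel]
  exact ((ContinuousLinearMap.compL ℝ (Fin k → ℝ) (Eu n) (Eu n) (tangentCoord q q)).contDiff
    (n := ∞)).contMDiff.contMDiffAt

end Coordinates

/-! ### Derivatives and exterior derivatives read in the preferred charts -/

section Charts

variable {E H M : Type*} [NormedAddCommGroup E] [NormedSpace ℝ E] [TopologicalSpace H]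
  {I : ModelWithCorners ℝ E H} [TopologicalSpace M] [ChartedSpace H M]
  {E' H' N : Type*} [NormedAddCommGroup E'] [NormedSpace ℝ E'] [TopologicalSpace H']
  {I' : ModelWithCorners ℝ E' H'} [TopologicalSpace N] [ChartedSpace H' N]

/-- The tangent map at `x`, with tangent spaces identified with the model spaces by the preferred
charts, is the derivative of any expression for the map in these charts. -/
theorem mfderiv_eq_of_writtenInExtChartAt [I.Boundaryless] {f : M → N} {x : M}
    (hf : MDifferentiableAt I I' f x) {g : E → E'} {g' : E →L[ℝ] E'}
    (hg : HasFDerivAt g g' (extChartAt I x x))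
    (h : ∀ᶠ x' in 𝓝 x, extChartAt I' (f x) (f x') = g (extChartAt I x x')) :
    mfderiv I I' f x = g' := by
  have hsymm : Filter.Tendsto (extChartAt I x).symm (𝓝 (extChartAt I x x)) (𝓝 x) := by
    simpa using! (continuousAt_extChartAt_symm (I := I) x).tendsto
  have h1 : writtenInExtChartAt I I' x f =ᶠ[𝓝 (extChartAt I x x)] g := by
    filter_upwards [hsymm.eventually h, extChartAt_target_mem_nhds (I := I) x] with y hy hy'
    rw [(extChartAt I x).right_inv hy'] at hy
    exact hy
  have h2 : HasFDerivWithinAt (writtenInExtChartAt I I' x f) g' (range I) (extChartAt I x x) :=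
    (hg.congr_of_eventuallyEq h1).hasFDerivWithinAt
  exact HasMFDerivAt.mfderiv ⟨hf.continuousAt, h2⟩

/-- The differential of a function at `x`, read in the preferred chart at `x`. Differentiability
of `f` follows from that of its expression, so it is not a hypothesis. -/
theorem dFun_eq_of_eventually [I.Boundaryless] [IsManifold I 1 M] {f : M → ℝ} {x : M} {g : E → ℝ}
    {g' : E →L[ℝ] ℝ} (hg : HasFDerivAt g g' (extChartAt I x x))
    (h : ∀ᶠ x' in 𝓝 x, f x' = g (extChartAt I x x')) : dFun I f x = g' := by
  refine mfderiv_eq_of_writtenInExtChartAt ?_ hg h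
  exact (hg.differentiableAt.mdifferentiableAt.comp x
    (mdifferentiableAt_extChartAt (mem_chart_source H x))).congr_of_eventuallyEq h

/-- The exterior derivative at `x` from any expression of the form in the preferred chart at `x`;
no chart change appears, as the derivative at `x` of this chart is the identity. -/
theorem oneForm_d_apply [IsManifold I 1 M] (θ : OneForm I M) (x : M) {g : E → E →L[ℝ] ℝ}
    {g' : E →L[ℝ] E →L[ℝ] ℝ} (hg : HasFDerivAt g g' (extChartAt I x x))
    (h : OneForm.inChart I θ x =ᶠ[𝓝 (extChartAt I x x)] g) (u w : TangentSpace I x) :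
    OneForm.d I θ x u w = g' u w - g' w u := by
  simp only [OneForm.d, LinearMap.mk₂_apply, mfderiv_extChartAt_self, h.fderiv_eq, hg.fderiv]
  rfl

end Charts

/-! ### Momenta and energy of a Lagrangian on `ℝ^n × (ℝ^n)^k` -/

section Local

-- Instances on nested spaces of continuous linear maps lie beyond the default search depth.
set_option maxSynthPendingDepth 3

variable {n k : ℕ}

theorem insertAt_apply (A : Fin k) (w : Eu n) (t : Fin k → ℝ) : insertAt A w t = t A • w := rfl

theorem sum_insertAt (v : FVel n k) :
    ∑ A, insertAt A (v (Pi.single A 1 : Fin k → ℝ)) = v := by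
  ext1 t
  rw [sum_apply]
  simp only [insertAt_apply, ← map_smul, ← map_sum]
  congr 1
  ext B
  simp [Finset.sum_apply, Pi.single_apply]

/-- The restriction of covectors of `ℝ^n × (ℝ^n)^k` to the second factor, a `k`-tuple of
covectors of `ℝ^n`. -/
def fibreDual (n k : ℕ) : ((Eu n × FVel n k) →L[ℝ] ℝ) →L[ℝ] FCov n k :=
  LinearMap.toContinuousLinearMap (𝕜 := ℝ) (E := (Eu n × FVel n k) →L[ℝ] ℝ) (F' := FCov n k)
    { toFun := fun a : (Eu n × FVel n k) →L[ℝ] ℝ => ContinuousLinearMap.pi fun A =>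
        a.comp ((ContinuousLinearMap.inr ℝ (Eu n) (FVel n k)).comp (insertAt A))
      map_add' := fun _ _ => rfl
      map_smul' := fun _ _ => rfl }

/-- The momenta `p^A_i = ∂ℓ/∂v^i_A` of a Lagrangian `ℓ` on `ℝ^n × (ℝ^n)^k`. -/
def momentum (ℓ : Eu n × FVel n k → ℝ) (y : Eu n × FVel n k) : FCov n k :=
  fibreDual n k (fderiv ℝ ℓ y)

theorem momentum_apply (ℓ : Eu n × FVel n k → ℝ) (y : Eu n × FVel n k) (w : Eu n) (A : Fin k) :
    momentum ℓ y w A = fderiv ℝ ℓ y (0, insertAt A w) := rfl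

/-- The pairing `∑ α^A(v_A)` of `k` covectors and `k` vectors of `ℝ^n`. -/
def pairing (n k : ℕ) : FCov n k →L[ℝ] FVel n k →L[ℝ] ℝ :=
  ∑ A : Fin k, ((ContinuousLinearMap.compL ℝ (FVel n k) (Eu n) ℝ).flip
      (ContinuousLinearMap.apply ℝ (Eu n) (Pi.single A 1 : Fin k → ℝ))).comp
    (ContinuousLinearMap.compL ℝ (Eu n) (Fin k → ℝ) ℝ (ContinuousLinearMap.proj A))

theorem pairing_apply (α : FCov n k) (v : FVel n k) :
    pairing n k α v = ∑ A, α (v (Pi.single A 1 : Fin k → ℝ)) A := by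
  rw [pairing, sum_apply, sum_apply]
  rfl

theorem pairing_momentum (ℓ : Eu n × FVel n k → ℝ) (y : Eu n × FVel n k) (v : FVel n k) :
    pairing n k (momentum ℓ y) v = fderiv ℝ ℓ y (0, v) := by
  simp only [pairing_apply, momentum_apply, ← map_sum]
  congr 1
  rw [Prod.ext_iff, Prod.fst_sum, Prod.snd_sum]
  simp [sum_insertAt]

/-- The energy `∑ v^i_A ∂ℓ/∂v^i_A - ℓ` of a Lagrangian `ℓ` on `ℝ^n × (ℝ^n)^k`. -/
def localEnergy (ℓ : Eu n × FVel n k → ℝ) (y : Eu n × FVel n k) : ℝ :=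
  pairing n k (momentum ℓ y) y.2 - ℓ y

end Local

/-! ### Lagrangian and Hamiltonian objects in induced coordinates -/

section Lagrangian

set_option maxSynthPendingDepth 3

variable {n k : ℕ} {Q : Type*} [TopologicalSpace Q] [ChartedSpace (Eu n) Q]
  [IsManifold (𝓡 n) ∞ Q] {L : Vel n k Q → ℝ}

theorem lagInChart_extChartAt (L : Vel n k Q → ℝ) {p₀ p : Vel n k Q}
    (hp : p ∈ (extChartAt (IVel n k) p₀).source) :
    lagInChart L p₀ (extChartAt (IVel n k) p₀ p) = L p := by
  rw [lagInChart, (extChartAt (IVel n k) p₀).left_inv hp]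

theorem contDiffAt_lagInChart (hL : ContMDiff (IVel n k) 𝓘(ℝ, ℝ) ∞ L) (p₀ : Vel n k Q)
    {y : Eu n × FVel n k} (hy : y ∈ (extChartAt (IVel n k) p₀).target) :
    ContDiffAt ℝ ∞ (lagInChart L p₀) y := by
  have h : ContMDiffAt 𝓘(ℝ, Eu n × FVel n k) 𝓘(ℝ, ℝ) ∞ (lagInChart L p₀) y := by
    refine (hL.contMDiffAt).comp y ?_
    exact (contMDiffOn_extChartAt_symm p₀).contMDiffAt ((isOpen_extChartAt_target p₀).mem_nhds hy)
  exact h.contDiffAt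

theorem contDiffAt_momentum (hL : ContMDiff (IVel n k) 𝓘(ℝ, ℝ) ∞ L) (p₀ : Vel n k Q)
    {y : Eu n × FVel n k} (hy : y ∈ (extChartAt (IVel n k) p₀).target) :
    ContDiffAt ℝ ∞ (momentum (lagInChart L p₀)) y :=
  have h : ContDiff ℝ ∞ (fibreDual n k) :=
    ContinuousLinearMap.contDiff (E := (Eu n × FVel n k) →L[ℝ] ℝ) (F := FCov n k) _
  h.contDiffAt.comp y ((contDiffAt_lagInChart hL p₀ hy).fderiv_right (m := ∞) (by simp))

/-- The derivative of a Lagrangian along a fibre, in induced coordinates around `p₀`: the vertical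
derivative of its expression, composed with the coordinates of the fibre. -/
theorem hasFDerivAt_fibre (hL : ContMDiff (IVel n k) 𝓘(ℝ, ℝ) ∞ L) {p₀ p : Vel n k Q}
    (hp : p ∈ (extChartAt (IVel n k) p₀).source) :
    HasFDerivAt (fun v : FVel n k => L (fibreIncl p.proj v))
      ((fderiv ℝ (lagInChart L p₀) (extChartAt (IVel n k) p₀ p)).comp
        ((ContinuousLinearMap.inr ℝ (Eu n) (FVel n k)).comp
          (ContinuousLinearMap.compL ℝ (Fin k → ℝ) (Eu n) (Eu n) (tangentCoord p₀.proj p.proj))))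
      p.snd := by
  have h1 : (fun v : FVel n k => L (fibreIncl p.proj v)) =
      fun v : FVel n k => lagInChart L p₀ (extChartAt (𝓡 n) p₀.proj p.proj,
        ContinuousLinearMap.compL ℝ (Fin k → ℝ) (Eu n) (Eu n) (tangentCoord p₀.proj p.proj) v) := by
    funext v
    have hv : fibreIncl p.proj v ∈ (extChartAt (IVel n k) p₀).source :=
      mem_extChartAt_source_vel.2 (mem_extChartAt_source_vel.1 hp)
    rw [← lagInChart_extChartAt L hv, extChartAt_vel]
    rfl
  rw [h1]
  have h2 := ((contDiffAt_lagInChart hL p₀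
    ((extChartAt (IVel n k) p₀).map_source hp)).differentiableAt (by simp)).hasFDerivAt
  rw [extChartAt_vel] at h2 ⊢
  exact HasFDerivAt.comp (f := fun v : FVel n k => (extChartAt (𝓡 n) p₀.proj p.proj,
        ContinuousLinearMap.compL ℝ (Fin k → ℝ) (Eu n) (Eu n) (tangentCoord p₀.proj p.proj) v))
    p.snd h2 ((hasFDerivAt_const _ _).prodMk (ContinuousLinearMap.hasFDerivAt _))

/-- In induced coordinates the Legendre map is `(q^i, v^i_A) ↦ (q^i, ∂L/∂v^i_A)`. -/
theorem legendre_comp_tangentCoordSymm (hL : ContMDiff (IVel n k) 𝓘(ℝ, ℝ) ∞ L) {p₀ p : Vel n k Q}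
    (hp : p ∈ (extChartAt (IVel n k) p₀).source) :
    ContinuousLinearMap.comp (legendre L p).snd (tangentCoordSymm p₀.proj p.proj) =
      momentum (lagInChart L p₀) (extChartAt (IVel n k) p₀ p) := by
  ext w A
  have hq := mem_extChartAt_source_vel.1 hp
  change fderiv ℝ (fun v : FVel n k => L (fibreIncl p.proj v)) p.snd
    (insertAt A (tangentCoordSymm p₀.proj p.proj w)) = _
  rw [(hasFDerivAt_fibre hL hp).fderiv, momentum_apply]
  change fderiv ℝ (lagInChart L p₀) (extChartAt (IVel n k) p₀ p)
    (0, (tangentCoord p₀.proj p.proj).comp (insertAt A (tangentCoordSymm p₀.proj p.proj w))) = _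
  congr 2
  ext1 t
  change tangentCoord p₀.proj p.proj (t A • tangentCoordSymm p₀.proj p.proj w) = t A • w
  rw [map_smul, tangentCoord_symm hq]

theorem energy_eq (hL : ContMDiff (IVel n k) 𝓘(ℝ, ℝ) ∞ L) {p₀ p : Vel n k Q}
    (hp : p ∈ (extChartAt (IVel n k) p₀).source) :
    energy L p = localEnergy (lagInChart L p₀) (extChartAt (IVel n k) p₀ p) := by
  have h1 := hasFDerivAt_fibre hL hp
  have h2 (v : FVel n k) : HasDerivAt (fun s : ℝ => Real.exp s • v) v 0 := by
    simpa using (Real.hasDerivAt_exp 0).smul_const v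
  have h0 (v : FVel n k) : v = Real.exp 0 • v := by simp
  have h3 := h1.comp_hasDerivAt_of_eq (0 : ℝ) (h2 p.snd) (h0 p.snd)
  rw [energy, localEnergy, lagInChart_extChartAt L hp, pairing_momentum]
  congr 1
  refine h3.deriv.trans ?_
  conv_rhs => rw [extChartAt_vel p₀ p]
  rw [extChartAt_vel]
  rfl

/-- `(θ_L)_A` is the pull-back of `(θ_0)_A` by the Legendre map: both are `FL(p)^A((τ_Q)_* W)`. -/
theorem thetaL_apply (hL : ContMDiff (IVel n k) 𝓘(ℝ, ℝ) ∞ L) (A : Fin k) (p : Vel n k Q)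
    (W : TangentSpace (IVel n k) p) :
    thetaL L A p W =
      ((legendre L p).snd (mfderiv (IVel n k) (𝓡 n) TotalSpace.proj p W) : Fin k → ℝ) A := by
  have h1 (q : Q) (v : FVel n k) : mfderiv 𝓘(ℝ, FVel n k) 𝓘(ℝ, ℝ) (L ∘ fibreIncl q) v =
      (mfderiv (IVel n k) 𝓘(ℝ, ℝ) L (fibreIncl q v)).comp
        (mfderiv 𝓘(ℝ, FVel n k) (IVel n k) (fibreIncl (n := n) (k := k) q) v) :=
    mfderiv_comp (x := v) (g := L) (hL.mdifferentiable (by simp) _)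
      ((contMDiff_fibreIncl q).mdifferentiable (by simp) _)
  have h2 (q : Q) (v : FVel n k) := (mfderiv_eq_fderiv (f := L ∘ fibreIncl q) (x := v)).symm.trans
    (h1 q v)
  exact (DFunLike.congr_fun (h2 p.proj p.snd)
    (insertAt A (mfderiv (IVel n k) (𝓡 n) TotalSpace.proj p W : Eu n))).symm

/-- The covector `(u, z) ↦ α^A(u)` of `ℝ^n × F`, for `α = (α^1, …, α^k)`. -/
def baseForm (F : Type*) [NormedAddCommGroup F] [NormedSpace ℝ F] (A : Fin k) :
    FCov n k →L[ℝ] (Eu n × F) →L[ℝ] ℝ :=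
  ((ContinuousLinearMap.compL ℝ (Eu n × F) (Eu n) ℝ).flip (ContinuousLinearMap.fst ℝ (Eu n) F)).comp
    (ContinuousLinearMap.compL ℝ (Eu n) (Fin k → ℝ) ℝ (ContinuousLinearMap.proj A))

theorem baseForm_apply {F : Type*} [NormedAddCommGroup F] [NormedSpace ℝ F] (A : Fin k)
    (α : FCov n k) (u : Eu n × F) : baseForm F A α u = α u.1 A := rfl

/-- The projection to the base is `(y, z) ↦ y` in induced coordinates, also at the points of the
chart domain other than its centre, where the identification of tangent spaces is not trivial. -/
theorem mfderiv_proj_extChartAt_symm {F : Type*} [NormedAddCommGroup F] [NormedSpace ℝ F]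
    {V : Q → Type*} [TopologicalSpace (TotalSpace F V)] [∀ q, TopologicalSpace (V q)]
    [∀ q, AddCommMonoid (V q)] [∀ q, Module ℝ (V q)] [FiberBundle F V] [VectorBundle ℝ F V]
    [ContMDiffVectorBundle ∞ F V (𝓡 n)] (p₀ : TotalSpace F V) {y : Eu n × F}
    (hy : y ∈ (extChartAt ((𝓡 n).prod 𝓘(ℝ, F)) p₀).target) (W : Eu n × F) :
    mfderiv ((𝓡 n).prod 𝓘(ℝ, F)) (𝓡 n) TotalSpace.proj
      ((extChartAt ((𝓡 n).prod 𝓘(ℝ, F)) p₀).symm y)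
      (mfderiv 𝓘(ℝ, Eu n × F) ((𝓡 n).prod 𝓘(ℝ, F))
        (extChartAt ((𝓡 n).prod 𝓘(ℝ, F)) p₀).symm y W) =
    tangentCoordSymm p₀.proj ((extChartAt ((𝓡 n).prod 𝓘(ℝ, F)) p₀).symm y).proj W.1 := by
  set Φ := extChartAt ((𝓡 n).prod 𝓘(ℝ, F)) p₀ with hΦ
  have hproj : ∀ z ∈ Φ.target, (Φ.symm z).proj = (extChartAt (𝓡 n) p₀.proj).symm z.1 := by
    intro z hz
    rw [hΦ, extChartAt_target] at hz
    exact FiberBundle.chartedSpace_chartAt_symm_fst p₀ z hz.1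
  have hmem : y.1 ∈ (extChartAt (𝓡 n) p₀.proj).target := by
    rw [hΦ, FiberBundle.extChartAt_target] at hy
    exact hy.1.1
  have hS : MDifferentiableAt 𝓘(ℝ, Eu n × F) ((𝓡 n).prod 𝓘(ℝ, F)) Φ.symm y :=
    ((contMDiffOn_extChartAt_symm (n := ∞) p₀).contMDiffAt
      ((isOpen_extChartAt_target p₀).mem_nhds hy)).mdifferentiableAt (by simp)
  have hP : MDifferentiableAt ((𝓡 n).prod 𝓘(ℝ, F)) (𝓡 n) (TotalSpace.proj (F := F) (E := V))
      (Φ.symm y) := (contMDiff_proj (n := ∞) V).mdifferentiable (by simp) _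
  have hB : MDifferentiableAt 𝓘(ℝ, Eu n) (𝓡 n) (extChartAt (𝓡 n) p₀.proj).symm y.1 :=
    ((contMDiffOn_extChartAt_symm (n := ∞) p₀.proj).contMDiffAt
      ((isOpen_extChartAt_target p₀.proj).mem_nhds hmem)).mdifferentiableAt (by simp)
  have hF : MDifferentiableAt 𝓘(ℝ, Eu n × F) 𝓘(ℝ, Eu n) (Prod.fst : Eu n × F → Eu n) y :=
    differentiableAt_fst.mdifferentiableAt
  have e0 := (TangentBundle.symmL_trivializationAt (I := 𝓡 n) (x₀ := p₀.proj)
    (x := (Φ.symm y).proj) (by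
      rw [hproj y hy]; simpa using (extChartAt (𝓡 n) p₀.proj).map_target hmem))
  rw [(𝓡 n).range_eq_univ, mfderivWithin_univ, hproj y hy,
    (extChartAt (𝓡 n) p₀.proj).right_inv hmem] at e0
  have e1 := mfderiv_comp y hP hS
  have e2 := mfderiv_comp y hB hF
  have e3 : (TotalSpace.proj (F := F) (E := V)) ∘ Φ.symm =ᶠ[𝓝 y]
      (extChartAt (𝓡 n) p₀.proj).symm ∘ Prod.fst :=
    Filter.eventuallyEq_of_mem ((isOpen_extChartAt_target p₀).mem_nhds hy) hproj
  rw [e3.mfderiv_eq, e2] at e1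
  rw [hproj y hy, tangentCoordSymm, e0]
  refine (DFunLike.congr_fun e1 W).symm.trans ?_
  have e4 : mfderiv 𝓘(ℝ, Eu n × F) 𝓘(ℝ, Eu n) (Prod.fst : Eu n × F → Eu n) y =
      ContinuousLinearMap.fst ℝ (Eu n) F := by
    rw [mfderiv_eq_fderiv, fderiv_fst]
  rw [e4]
  rfl

theorem inChart_thetaL (hL : ContMDiff (IVel n k) 𝓘(ℝ, ℝ) ∞ L) (A : Fin k) (p₀ : Vel n k Q)
    {y : Eu n × FVel n k} (hy : y ∈ (extChartAt (IVel n k) p₀).target) :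
    OneForm.inChart (IVel n k) (thetaL L A) p₀ y =
      baseForm (FVel n k) A (momentum (lagInChart L p₀) y) := by
  refine ContinuousLinearMap.ext fun W => ?_
  have h1 := legendre_comp_tangentCoordSymm hL ((extChartAt (IVel n k) p₀).map_target hy)
  rw [(extChartAt (IVel n k) p₀).right_inv hy] at h1
  rw [baseForm_apply, ← h1]
  refine (thetaL_apply hL A _ _).trans ?_
  exact congrArg (fun u : Eu n =>
    ((legendre L ((extChartAt (IVel n k) p₀).symm y)).snd u : Fin k → ℝ) A)
    (mfderiv_proj_extChartAt_symm p₀ hy W)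

theorem inChart_theta0 (A : Fin k) (α₀ : Cov n k Q)
    {y : Eu n × FCov n k} (hy : y ∈ (extChartAt (ICov n k) α₀).target) :
    OneForm.inChart (ICov n k) (theta0 A) α₀ y = baseForm (FCov n k) A y.2 := by
  refine ContinuousLinearMap.ext fun W => ?_
  have h1 := congrArg Prod.snd
    (extChartAt_cov α₀ ((extChartAt (ICov n k) α₀).symm y))
  rw [(extChartAt (ICov n k) α₀).right_inv hy] at h1
  rw [baseForm_apply, h1]
  change (((extChartAt (ICov n k) α₀).symm y).snd (mfderiv (ICov n k) (𝓡 n) TotalSpace.proj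
    ((extChartAt (ICov n k) α₀).symm y) (mfderiv 𝓘(ℝ, Eu n × FCov n k) (ICov n k)
      (extChartAt (ICov n k) α₀).symm y W)) : Fin k → ℝ) A = _
  rw [mfderiv_proj_extChartAt_symm α₀ hy]
  rfl

theorem hasFDerivAt_momentum (hL : ContMDiff (IVel n k) 𝓘(ℝ, ℝ) ∞ L) (p : Vel n k Q) :
    HasFDerivAt (momentum (lagInChart L p))
      (fderiv ℝ (momentum (lagInChart L p)) (extChartAt (IVel n k) p p))
      (extChartAt (IVel n k) p p) :=
  ((contDiffAt_momentum hL p (mem_extChartAt_target p)).differentiableAt (by simp)).hasFDerivAt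

theorem hasFDerivAt_lagInChart (hL : ContMDiff (IVel n k) 𝓘(ℝ, ℝ) ∞ L) (p : Vel n k Q) :
    HasFDerivAt (lagInChart L p)
      (fderiv ℝ (lagInChart L p) (extChartAt (IVel n k) p p)) (extChartAt (IVel n k) p p) :=
  ((contDiffAt_lagInChart hL p (mem_extChartAt_target p)).differentiableAt (by simp)).hasFDerivAt

/-- `(ω_L)_A = dq^i ∧ d(∂L/∂v^i_A)`, at the centre of the chart. -/
theorem omegaL_apply (hL : ContMDiff (IVel n k) 𝓘(ℝ, ℝ) ∞ L) (A : Fin k) (p : Vel n k Q)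
    (U W : Eu n × FVel n k) :
    omegaL L A p U W =
      fderiv ℝ (momentum (lagInChart L p)) (extChartAt (IVel n k) p p) W U.1 A -
      fderiv ℝ (momentum (lagInChart L p)) (extChartAt (IVel n k) p p) U W.1 A := by
  have h1 := (baseForm (n := n) (k := k) (FVel n k) A).hasFDerivAt.comp _
    (hasFDerivAt_momentum hL p)
  have h2 := oneForm_d_apply (thetaL L A) p h1 (Filter.eventuallyEq_of_mem
    (extChartAt_target_mem_nhds p) fun y hy => inChart_thetaL hL A p hy) U W
  change -(OneForm.d (IVel n k) (thetaL L A) p U W) = _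
  rw [h2, neg_sub]
  rfl

/-- `(ω_0)_A = dq^i ∧ dp^A_i`, at the centre of the chart. -/
theorem omega0_apply (A : Fin k) (α : Cov n k Q) (U W : Eu n × FCov n k) :
    omega0 A α U W = W.2 U.1 A - U.2 W.1 A := by
  have h1 := (baseForm (n := n) (k := k) (FCov n k) A).hasFDerivAt.comp
    (extChartAt (ICov n k) α α) (hasFDerivAt_snd (𝕜 := ℝ))
  have h2 := oneForm_d_apply (theta0 A) α h1 (Filter.eventuallyEq_of_mem
    (extChartAt_target_mem_nhds α) fun y hy => inChart_theta0 A α hy) U W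
  change -(OneForm.d (ICov n k) (theta0 A) α U W) = _
  rw [h2, neg_sub]
  rfl

theorem mfderiv_pr2 (w : Uni n k Q) (W : Eu n × (FVel n k × FCov n k)) :
    mfderiv (IUni n k) (ICov n k) pr2 w W = (W.1, W.2.2) := by
  have h := mfderiv_eq_of_writtenInExtChartAt (contMDiff_pr2.mdifferentiable (by simp) w)
    ((ContinuousLinearMap.fst ℝ (Eu n) (FVel n k × FCov n k)).prod
      ((ContinuousLinearMap.snd ℝ (FVel n k) (FCov n k)).comp
        (ContinuousLinearMap.snd ℝ (Eu n) (FVel n k × FCov n k)))).hasFDerivAt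
    (Filter.Eventually.of_forall fun w' => by
      rw [extChartAt_cov, extChartAt_uni]
      rfl)
  rw [h]
  rfl

/-- `Ω_A = dq^i ∧ dp^A_i`, at the centre of the chart of the Whitney sum. -/
theorem Omega_apply (A : Fin k) (w : Uni n k Q) (U W : Eu n × (FVel n k × FCov n k)) :
    Omega A w U W = W.2.2 U.1 A - U.2.2 W.1 A := by
  change omega0 A (pr2 w) (mfderiv (IUni n k) (ICov n k) pr2 w U)
    (mfderiv (IUni n k) (ICov n k) pr2 w W) = _
  rw [mfderiv_pr2, mfderiv_pr2]
  exact omega0_apply A (pr2 w) (U.1, U.2.2) (W.1, W.2.2)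

theorem extChartAt_idSumFL (hL : ContMDiff (IVel n k) 𝓘(ℝ, ℝ) ∞ L) {p₀ p : Vel n k Q}
    (hp : p ∈ (extChartAt (IVel n k) p₀).source) :
    extChartAt (IUni n k) (idSumFL L p₀) (idSumFL L p) =
      ((extChartAt (IVel n k) p₀ p).1, ((extChartAt (IVel n k) p₀ p).2,
        momentum (lagInChart L p₀) (extChartAt (IVel n k) p₀ p))) := by
  rw [extChartAt_uni, ← legendre_comp_tangentCoordSymm hL hp, extChartAt_vel]
  rfl

theorem contMDiff_idSumFL (hL : ContMDiff (IVel n k) 𝓘(ℝ, ℝ) ∞ L) :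
    ContMDiff (IVel n k) (IUni n k) ∞ (idSumFL L) := by
  intro p₀
  refine contMDiffAt_totalSpace.2 ⟨contMDiffAt_proj _, ?_⟩
  have hc : ContMDiffAt (IVel n k) 𝓘(ℝ, Eu n × FVel n k) ∞ (extChartAt (IVel n k) p₀) p₀ :=
    contMDiffAt_extChartAt
  have hm := (contDiffAt_momentum hL p₀ (mem_extChartAt_target p₀)).contMDiffAt.comp p₀ hc
  have h2 := (contDiff_snd (n := ∞)).contMDiff.contMDiffAt.comp p₀ hc
  refine (h2.prodMk_space hm).congr_of_eventuallyEq ?_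
  filter_upwards [extChartAt_source_mem_nhds (I := IVel n k) p₀] with p hp
  rw [trivializationAt_uni]
  refine Prod.ext ?_ ?_
  · simp only [Function.comp, extChartAt_vel]
    rfl
  · exact legendre_comp_tangentCoordSymm hL hp

/-- The tangent map of `Id ⊕ FL` sends `(a, b)` to `(a, b, D(∂L/∂v)(a, b))`. -/
theorem mfderiv_idSumFL (hL : ContMDiff (IVel n k) 𝓘(ℝ, ℝ) ∞ L) (p : Vel n k Q)
    (W : Eu n × FVel n k) :
    mfderiv (IVel n k) (IUni n k) (idSumFL L) p W = (W.1, (W.2,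
      fderiv ℝ (momentum (lagInChart L p)) (extChartAt (IVel n k) p p) W)) := by
  have h := mfderiv_eq_of_writtenInExtChartAt ((contMDiff_idSumFL hL).mdifferentiable (by simp) p)
    (hasFDerivAt_fst.prodMk (hasFDerivAt_snd.prodMk (hasFDerivAt_momentum hL p)))
    (Filter.eventually_of_mem (extChartAt_source_mem_nhds p) fun p' hp' =>
      extChartAt_idSumFL hL hp')
  rw [h]
  rfl

theorem mfderiv_proj_vel (p : Vel n k Q) (W : Eu n × FVel n k) :
    mfderiv (IVel n k) (𝓡 n) TotalSpace.proj p W = W.1 := by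
  have h := mfderiv_eq_of_writtenInExtChartAt ((contMDiff_proj
      (fun q : Q => Trivial Q (Fin k → ℝ) q →L[ℝ] TangentSpace (𝓡 n) q)
      (n := ∞)).mdifferentiable (by simp) p)
    (ContinuousLinearMap.fst ℝ (Eu n) (FVel n k)).hasFDerivAt
    (Filter.Eventually.of_forall fun p' => by
      rw [extChartAt_vel]
      rfl)
  rw [h]
  rfl

theorem tangentCoord_self (q : Q) (w : Eu n) : tangentCoord q q w = w := by
  have h := TangentBundle.continuousLinearMapAt_trivializationAt (I := 𝓡 n) (x₀ := q) (x := q)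
    (mem_chart_source _ q)
  rw [mfderiv_extChartAt_self] at h
  exact DFunLike.congr_fun h w

/-- `dE_L = ∑ v^i_A d(∂L/∂v^i_A) - ∂L/∂q^i dq^i`: the terms `∂L/∂v^i_A dv^i_A` cancel. -/
theorem dFun_energy (hL : ContMDiff (IVel n k) 𝓘(ℝ, ℝ) ∞ L) (p : Vel n k Q)
    (W : Eu n × FVel n k) :
    dFun (IVel n k) (energy L) p W =
      pairing n k (fderiv ℝ (momentum (lagInChart L p)) (extChartAt (IVel n k) p p) W)
        (extChartAt (IVel n k) p p).2 -
      fderiv ℝ (lagInChart L p) (extChartAt (IVel n k) p p) (W.1, 0) := by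
  have h1 := ((pairing n k).hasFDerivAt_of_bilinear (hasFDerivAt_momentum hL p)
    (hasFDerivAt_snd (𝕜 := ℝ))).sub (hasFDerivAt_lagInChart hL p)
  have h2 := dFun_eq_of_eventually (f := energy L) h1
    (Filter.eventually_of_mem (extChartAt_source_mem_nhds p) fun p' hp' => energy_eq hL hp')
  rw [h2]
  change (pairing n k (momentum (lagInChart L p) (extChartAt (IVel n k) p p)) W.2 +
    pairing n k (fderiv ℝ (momentum (lagInChart L p)) (extChartAt (IVel n k) p p) W)
      (extChartAt (IVel n k) p p).2) -
      fderiv ℝ (lagInChart L p) (extChartAt (IVel n k) p p) W = _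
  have h3 : W = (W.1, 0) + (0, W.2) := by simp
  rw [pairing_momentum]
  conv_lhs => enter [2]; rw [h3, map_add]
  ring

theorem coupling_eq (w₀ w : Uni n k Q) (hw : w ∈ (extChartAt (IUni n k) w₀).source) :
    coupling w = pairing n k (extChartAt (IUni n k) w₀ w).2.2 (extChartAt (IUni n k) w₀ w).2.1 := by
  rw [extChartAt_uni, pairing_apply, coupling]
  refine Finset.sum_congr rfl fun A _ => ?_
  exact congrArg (fun u : Eu n => (w.snd.2 u : Fin k → ℝ) A) (tangentCoordSymm_coord
    (mem_extChartAt_source_uni.1 hw) (w.snd.1 (Pi.single A 1 : Fin k → ℝ))).symm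

/-- The derivative of the coordinate expression `∑ p^A_i v^i_A - ℓ(q, v)` of the Hamiltonian. -/
theorem hasFDerivAt_pairing_sub {ℓ : Eu n × FVel n k → ℝ} {ℓ' : (Eu n × FVel n k) →L[ℝ] ℝ}
    {z : Eu n × (FVel n k × FCov n k)} (h : HasFDerivAt ℓ ℓ' (z.1, z.2.1)) :
    ∃ D : (Eu n × (FVel n k × FCov n k)) →L[ℝ] ℝ,
      HasFDerivAt (fun y : Eu n × (FVel n k × FCov n k) =>
        pairing n k y.2.2 y.2.1 - ℓ (y.1, y.2.1)) D z ∧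
      ∀ W, D W = pairing n k z.2.2 W.2.1 + pairing n k W.2.2 z.2.1 - ℓ' (W.1, W.2.1) := by
  have hv : HasFDerivAt (fun y : Eu n × (FVel n k × FCov n k) => y.2.1)
      ((ContinuousLinearMap.fst ℝ (FVel n k) (FCov n k)).comp
        (ContinuousLinearMap.snd ℝ (Eu n) (FVel n k × FCov n k))) z :=
    hasFDerivAt_fst.comp z hasFDerivAt_snd
  have hα : HasFDerivAt (fun y : Eu n × (FVel n k × FCov n k) => y.2.2)
      ((ContinuousLinearMap.snd ℝ (FVel n k) (FCov n k)).comp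
        (ContinuousLinearMap.snd ℝ (Eu n) (FVel n k × FCov n k))) z :=
    hasFDerivAt_snd.comp z hasFDerivAt_snd
  have hyv := (hasFDerivAt_fst (𝕜 := ℝ) (p := z)).prodMk hv
  exact ⟨_, ((pairing n k).hasFDerivAt_of_bilinear hα hv).sub
    (HasFDerivAt.comp (f := fun y : Eu n × (FVel n k × FCov n k) => (y.1, y.2.1)) z h hyv),
    fun W => rfl⟩

/-- Along the graph of `FL`, `d𝓗 = ∑ v^i_A dp^A_i - ∂L/∂q^i dq^i`: there `p^A_i = ∂L/∂v^i_A`, and the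
terms in `dv^i_A` cancel. -/
theorem dFun_hamiltonian (hL : ContMDiff (IVel n k) 𝓘(ℝ, ℝ) ∞ L) (p : Vel n k Q)
    (W : Eu n × (FVel n k × FCov n k)) :
    dFun (IUni n k) (hamiltonian L) (idSumFL L p) W =
      pairing n k W.2.2 (extChartAt (IVel n k) p p).2 -
      fderiv ℝ (lagInChart L p) (extChartAt (IVel n k) p p) (W.1, 0) := by
  have h0 := extChartAt_idSumFL hL (mem_extChartAt_source (I := IVel n k) p)
  obtain ⟨D, hD, hDW⟩ := hasFDerivAt_pairing_sub
    (z := ((extChartAt (IVel n k) p p).1, ((extChartAt (IVel n k) p p).2,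
        momentum (lagInChart L p) (extChartAt (IVel n k) p p)))) (hasFDerivAt_lagInChart hL p)
  rw [← h0] at hD
  have h2 := dFun_eq_of_eventually (f := hamiltonian L) hD
    (Filter.eventually_of_mem (extChartAt_source_mem_nhds (idSumFL L p)) fun w hw => by
      have hp : pr1 w ∈ (extChartAt (IVel n k) p).source :=
        mem_extChartAt_source_vel.2 (mem_extChartAt_source_uni.1 hw)
      rw [hamiltonian, coupling_eq _ w hw, ← lagInChart_extChartAt L hp, extChartAt_vel,
        extChartAt_uni]
      rfl)
  have h3 : (W.1, W.2.1) = (W.1, 0) + (0, W.2.1) := by simp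
  refine (DFunLike.congr_fun h2 W).trans ((hDW W).trans ?_)
  rw [pairing_momentum, h3, map_add]
  ring

/-! ### The Lagrangian field equation at a point -/

theorem hasFDerivAt_fderiv_dirV (hL : ContMDiff (IVel n k) 𝓘(ℝ, ℝ) ∞ L) (p : Vel n k Q)
    (i : Fin n) (A : Fin k) :
    HasFDerivAt (fun y => fderiv ℝ (lagInChart L p) y (dirV i A))
      ((ContinuousLinearMap.proj A).comp
        ((ContinuousLinearMap.apply ℝ (Fin k → ℝ) (EuclideanSpace.single i (1 : ℝ) : Eu n)).comp
        (fderiv ℝ (momentum (lagInChart L p)) (extChartAt (IVel n k) p p))))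
      (extChartAt (IVel n k) p p) :=
  ((ContinuousLinearMap.proj (R := ℝ) (φ := fun _ : Fin k => ℝ) A).comp
    (ContinuousLinearMap.apply ℝ (Fin k → ℝ)
      (EuclideanSpace.single i (1 : ℝ) : Eu n))).hasFDerivAt.comp _
    (hasFDerivAt_momentum hL p)

/-- Regularity as nondegeneracy: the vectors `u_A` vanish if the vertical Hessian pairs them to zero
with every vertical direction. -/
theorem eq_zero_of_isRegularLagrangian (hL : ContMDiff (IVel n k) 𝓘(ℝ, ℝ) ∞ L)
    (hreg : IsRegularLagrangian L) (p : Vel n k Q) {u : Fin k → Eu n}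
    (hu : ∀ z : FVel n k, ∑ A, fderiv ℝ (momentum (lagInChart L p)) (extChartAt (IVel n k) p p)
      (0, z) (u A) A = 0) : u = 0 := by
  have key : (fun b : Fin n × Fin k => u b.2 b.1) = 0 := by
    refine Matrix.eq_zero_of_mulVec_eq_zero (hreg p) (funext fun a => ?_)
    -- The row `a` of the Hessian matrix belongs to the direction `∂/∂v^i_A` with `a = (i, A)`.
    have h := hu (insertAt a.2 (EuclideanSpace.single a.1 1))
    rw [Matrix.mulVec, dotProduct, Fintype.sum_prod_type_right, Pi.zero_apply, ← h]
    refine Finset.sum_congr rfl fun A _ => ?_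
    have h1 : u A = ∑ i, u A i • (EuclideanSpace.single i (1 : ℝ) : Eu n) := by
      simpa using ((EuclideanSpace.basisFun (Fin n) ℝ).sum_repr (u A)).symm
    conv_rhs => rw [h1, map_sum, Finset.sum_apply]
    refine Finset.sum_congr rfl fun i _ => ?_
    rw [Matrix.of_apply, (hasFDerivAt_fderiv_dirV hL p i A).fderiv, map_smul, Pi.smul_apply,
      smul_eq_mul, mul_comm]
    rfl
  funext A
  ext i
  exact congrFun key (i, A)

/-- Evaluated on vertical vectors, the Lagrangian field equation at `p` says that the vertical
Hessian annihilates `(X_A)^i - v^i_A`, so that `X` is a second order field by regularity. Evaluated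
on horizontal vectors it then says `∑_A X_A(∂L/∂v^i_A) = ∂L/∂q^i`. -/
theorem secondOrder_and_eulerLagrange_of_fieldEq (hL : ContMDiff (IVel n k) 𝓘(ℝ, ℝ) ∞ L)
    (hreg : IsRegularLagrangian L) (p : Vel n k Q) (U : Fin k → Eu n × FVel n k)
    (hU : ∀ W : Eu n × FVel n k,
      ∑ A, omegaL L A p (U A) W = dFun (IVel n k) (energy L) p W) :
    (∀ A, (U A).1 = (extChartAt (IVel n k) p p).2 (Pi.single A 1 : Fin k → ℝ)) ∧
    ∀ w : Eu n, ∑ A, fderiv ℝ (momentum (lagInChart L p)) (extChartAt (IVel n k) p p) (U A) w A =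
      fderiv ℝ (lagInChart L p) (extChartAt (IVel n k) p p) (w, 0) := by
  have hU' : ∀ W : Eu n × FVel n k, _ := fun W => by
    have h := hU W
    rw [dFun_energy hL, pairing_apply] at h
    simp only [omegaL_apply hL, Finset.sum_sub_distrib] at h
    exact h
  -- On vertical `W` only the terms in `Dμ(W)` are left, where `μ` are the momenta.
  have h1 : (fun A => (U A).1 - (extChartAt (IVel n k) p p).2 (Pi.single A 1 : Fin k → ℝ)) = 0 := by
    refine eq_zero_of_isRegularLagrangian hL hreg p fun z => ?_
    have h := hU' (0, z)
    simp only [map_zero, Pi.zero_apply, Finset.sum_const_zero, sub_zero, Prod.mk_zero_zero] at h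
    simp only [map_sub, Pi.sub_apply, Finset.sum_sub_distrib]
    rw [h, sub_self]
  have h2 : ∀ A, (U A).1 = (extChartAt (IVel n k) p p).2 (Pi.single A 1 : Fin k → ℝ) :=
    fun A => sub_eq_zero.1 (congrFun h1 A)
  refine ⟨h2, fun w => ?_⟩
  -- As `(X_A)^i = v^i_A`, the terms in `Dμ(W)` on the two sides are the same.
  have h := hU' (w, 0)
  simp only [h2] at h
  linarith

end Lagrangian

/-! ### Curves with prescribed velocity -/

section Curves

variable {E H M : Type*} [NormedAddCommGroup E] [NormedSpace ℝ E] [TopologicalSpace H]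
  {I : ModelWithCorners ℝ E H} [TopologicalSpace M] [ChartedSpace H M]

/-- Every tangent vector is the velocity of a curve, namely of a line in a chart. -/
theorem exists_curve_velocity_eq [I.Boundaryless] [IsManifold I ∞ M] (p : M)
    (u : TangentSpace I p) :
    ∃ γ : ℝ → M, ContMDiffAt 𝓘(ℝ, ℝ) I ∞ γ 0 ∧
      (⟨γ 0, velocity I γ 0⟩ : TangentBundle I M) = ⟨p, u⟩ := by
  let u' : E := u
  let ℓ : ℝ → E := fun s => extChartAt I p p + s • u'
  have hℓ : ContDiff ℝ ∞ ℓ := contDiff_const.add (contDiff_id.smul contDiff_const)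
  have hℓ' : HasFDerivAt ℓ ((ContinuousLinearMap.id ℝ ℝ).smulRight u') 0 :=
    ((hasFDerivAt_id (0 : ℝ)).smul_const u').const_add _
  have hℓ0 : ℓ 0 = extChartAt I p p := by simp [ℓ]
  have hmem : ∀ᶠ s in 𝓝 (0 : ℝ), ℓ s ∈ (extChartAt I p).target :=
    hℓ.continuous.continuousAt.eventually (by rw [hℓ0]; exact extChartAt_target_mem_nhds p)
  let γ : ℝ → M := fun s => (extChartAt I p).symm (ℓ s)
  have hγ0 : γ 0 = p := by simp [γ, hℓ0]
  have hγ : ContMDiffAt 𝓘(ℝ, ℝ) I ∞ γ 0 := by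
    refine ContMDiffAt.comp (I' := 𝓘(ℝ, E)) (0 : ℝ) ?_ hℓ.contMDiff.contMDiffAt
    exact (contMDiffOn_extChartAt_symm p).contMDiffAt
      ((isOpen_extChartAt_target p).mem_nhds hmem.self_of_nhds)
  refine ⟨γ, hγ, ?_⟩
  have h := mfderiv_eq_of_writtenInExtChartAt (hγ.mdifferentiableAt (by simp)) hℓ' (by
    filter_upwards [hmem] with s hs
    rw [hγ0]
    exact (extChartAt I p).right_inv hs)
  refine TotalSpace.ext hγ0 (heq_of_eq ?_)
  rw [velocity, h]
  exact one_smul ℝ u'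

end Curves

/-! ### The unified formalism -/

section Unified

set_option maxSynthPendingDepth 3

variable {n k : ℕ} {Q : Type*} [TopologicalSpace Q] [ChartedSpace (Eu n) Q] {L : Vel n k Q → ℝ}

theorem idSumFL_injective (L : Vel n k Q → ℝ) : Function.Injective (idSumFL L) :=
  Function.LeftInverse.injective (g := pr1) fun _ => rfl

theorem idSumFL_mem_ML (L : Vel n k Q → ℝ) (p : Vel n k Q) : idSumFL L p ∈ ML L := rfl

/-- The graph of `FL` is the image of `Id ⊕ FL`. -/
theorem idSumFL_pr1 {w : Uni n k Q} (hw : w ∈ ML L) : idSumFL L (pr1 w) = w := by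
  obtain ⟨q, v, α⟩ := w
  have h : (⟨q, α⟩ : Cov n k Q) = ⟨q, (legendre L ⟨q, v⟩).snd⟩ := hw
  have h' := TotalSpace.mk_inj.1 h
  change (⟨q, (v, (legendre L ⟨q, v⟩).snd)⟩ : Uni n k Q) = ⟨q, (v, α)⟩
  rw [h']

variable [IsManifold (𝓡 n) ∞ Q]

/-- The map `w ↦ T(Id ⊕ FL)(X_A(pr₁ w))` is smooth on the whole Whitney sum and coincides with the
push-forward of `X_A` on the graph of `FL`. -/
theorem smoothOn_pushforward_idSumFL (hL : ContMDiff (IVel n k) 𝓘(ℝ, ℝ) ∞ L)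
    {X : Fin k → (p : Vel n k Q) → TangentSpace (IVel n k) p}
    (hX : SmoothOn (IVel n k) X Set.univ) :
    SmoothOn (IUni n k)
      (fun A => pushforward (IVel n k) (IUni n k) (idSumFL L) (X A)) (ML L) := by
  intro A
  have h1 := (contMDiff_idSumFL hL).contMDiff_tangentMap (m := ∞) (by simp)
  have h2 := (h1.comp (contMDiffOn_univ.1 (hX A))).comp contMDiff_pr1
  refine h2.contMDiffOn.congr fun w hw => ?_
  obtain ⟨p, rfl⟩ : ∃ p, idSumFL L p = w := ⟨_, idSumFL_pr1 hw⟩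
  beta_reduce
  rw [pushforward_apply _ _ (idSumFL_injective L)]
  rfl

/-- The map `Id ⊕ FL` takes values in the graph of `FL`, so it sends curves to curves in the graph
and its tangent map sends tangent vectors to vectors tangent to the graph. -/
theorem isTangentTo_ML (hL : ContMDiff (IVel n k) 𝓘(ℝ, ℝ) ∞ L) (p : Vel n k Q)
    (u : TangentSpace (IVel n k) p) :
    IsTangentTo (IUni n k) (ML L) (idSumFL L p)
      (mfderiv (IVel n k) (IUni n k) (idSumFL L) p u) := by
  obtain ⟨γ, hγ, hγu⟩ := exists_curve_velocity_eq p u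
  refine ⟨idSumFL L ∘ γ, (contMDiff_idSumFL hL).contMDiffAt.comp 0 hγ,
    Filter.Eventually.of_forall fun s => idSumFL_mem_ML L (γ s), ?_⟩
  have h := mfderiv_comp (0 : ℝ) ((contMDiff_idSumFL hL).mdifferentiable (by simp) (γ 0))
    (hγ.mdifferentiableAt (by simp))
  refine Eq.trans ?_ (congrArg (tangentMap (IVel n k) (IUni n k) (idSumFL L)) hγu)
  rw [velocity, h]
  rfl

/-- With `X_A = v_A ∂/∂q + …`, both sides of the unified equation are
`∑ v^i_A dp^A_i - X_A(∂L/∂v^i_A) dq^i`; the second terms agree by the Euler-Lagrange part of the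
Lagrangian field equation. -/
theorem fieldEqAt_Omega (hL : ContMDiff (IVel n k) 𝓘(ℝ, ℝ) ∞ L) (hreg : IsRegularLagrangian L)
    {X : Fin k → (p : Vel n k Q) → TangentSpace (IVel n k) p} {p : Vel n k Q}
    (hsol : FieldEqAt (IVel n k) (omegaL L) (dFun (IVel n k) (energy L)) X p) :
    FieldEqAt (IUni n k) Omega (dFun (IUni n k) (hamiltonian L))
      (fun A => pushforward (IVel n k) (IUni n k) (idSumFL L) (X A)) (idSumFL L p) := by
  intro W
  obtain ⟨h1, h2⟩ := secondOrder_and_eulerLagrange_of_fieldEq hL hreg p (fun A => X A p) hsol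
  refine Eq.trans ?_ (dFun_hamiltonian hL p W).symm
  rw [← h2, pairing_apply, ← Finset.sum_sub_distrib]
  refine Finset.sum_congr rfl fun A _ => ?_
  beta_reduce
  rw [pushforward_apply _ _ (idSumFL_injective L), ← h1]
  have h3 := mfderiv_idSumFL hL p (X A p)
  refine (congrArg (fun U => Omega A (idSumFL L p) U W) h3).trans ?_
  exact Omega_apply A (idSumFL L p) _ W

end Unified

/-! ### Integral sections -/

section IntegralSections

set_option maxSynthPendingDepth 3

variable {n k : ℕ} {Q : Type*} [TopologicalSpace Q] [ChartedSpace (Eu n) Q]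
  [IsManifold (𝓡 n) ∞ Q] {L : Vel n k Q → ℝ}
  {X : Fin k → (p : Vel n k Q) → TangentSpace (IVel n k) p}
  {U : Set (Fin k → ℝ)} {ψ : (Fin k → ℝ) → Vel n k Q}

/-- Integral sections of second order fields are first prolongations. -/
theorem IsIntegralSection.eq_prolong (hψ : IsIntegralSection (IVel n k) X U ψ)
    (hX : ∀ p A, mfderiv (IVel n k) (𝓡 n) TotalSpace.proj p (X A p) =
      p.snd (Pi.single A 1 : Fin k → ℝ)) {t : Fin k → ℝ} (ht : t ∈ U) :
    ψ t = prolong (fun s => (ψ s).proj) t := by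
  have hψt : MDifferentiableAt 𝓘(ℝ, Fin k → ℝ) (IVel n k) ψ t :=
    (hψ.smooth.contMDiffAt (hψ.isOpen.mem_nhds ht)).mdifferentiableAt (by simp)
  have h := mfderiv_comp t ((contMDiff_proj
    (fun q : Q => Trivial Q (Fin k → ℝ) q →L[ℝ] TangentSpace (𝓡 n) q)
      (n := ∞)).mdifferentiable (by simp) (ψ t)) hψt
  have key : ∀ (a b : FVel n k), (∀ A, a (Pi.single A 1 : Fin k → ℝ) =
      b (Pi.single A 1 : Fin k → ℝ)) → a = b := fun a b hab => by
    rw [← sum_insertAt a, ← sum_insertAt b]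
    simp only [hab]
  have h' : (ψ t).snd = mfderiv 𝓘(ℝ, Fin k → ℝ) (𝓡 n) (fun s => (ψ s).proj) t := by
    refine key _ _ fun A => ?_
    refine ((DFunLike.congr_fun h (Pi.single A 1 : Fin k → ℝ)).trans ?_).symm
    refine Eq.trans ?_ (hX (ψ t) A)
    exact congrArg (mfderiv (IVel n k) (𝓡 n) TotalSpace.proj (ψ t)) (hψ.eq t ht A)
  change (⟨(ψ t).proj, (ψ t).snd⟩ : Vel n k Q) = _
  rw [h']
  rfl

/-- Along an integral section of `X`, the derivative `∂/∂t^A` of `∂L/∂v^i_A` is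
`X_A(∂L/∂v^i_A)`. -/
theorem IsIntegralSection.isEulerLagrangeSol (hψ : IsIntegralSection (IVel n k) X U ψ)
    (hL : ContMDiff (IVel n k) 𝓘(ℝ, ℝ) ∞ L)
    (hEL : ∀ p (w : Eu n), ∑ A, fderiv ℝ (momentum (lagInChart L p))
      (extChartAt (IVel n k) p p) (X A p) w A =
      fderiv ℝ (lagInChart L p) (extChartAt (IVel n k) p p) (w, 0))
    (hprol : ∀ t ∈ U, ψ t = prolong (fun s => (ψ s).proj) t) :
    IsEulerLagrangeSol L U (fun s => (ψ s).proj) := by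
  refine ⟨(contMDiff_proj _).comp_contMDiffOn hψ.smooth, fun t ht i => ?_⟩
  rw [← hprol t ht]
  intro p
  have hψt : MDifferentiableAt 𝓘(ℝ, Fin k → ℝ) (IVel n k) ψ t :=
    (hψ.smooth.contMDiffAt (hψ.isOpen.mem_nhds ht)).mdifferentiableAt (by simp)
  have h1 : HasFDerivAt (fun s => extChartAt (IVel n k) p (ψ s))
      (mfderiv 𝓘(ℝ, Fin k → ℝ) (IVel n k) ψ t : (Fin k → ℝ) →L[ℝ] Eu n × FVel n k) t := by
    have h0 := hψt.hasMFDerivAt.2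
    rw [ModelWithCorners.range_eq_univ] at h0
    exact HasFDerivWithinAt.hasFDerivAt_of_univ h0
  refine Eq.trans (Finset.sum_congr rfl fun A _ => ?_)
    (hEL p (EuclideanSpace.single i (1 : ℝ)))
  have h2 : (fun s : Fin k → ℝ => fderiv ℝ (lagInChart L p)
      (extChartAt (IVel n k) p (prolong (fun s => (ψ s).proj) s : Vel n k Q)) (dirV i A)) =ᶠ[𝓝 t]
      fun s => fderiv ℝ (lagInChart L p) (extChartAt (IVel n k) p (ψ s)) (dirV i A) := by
    filter_upwards [hψ.isOpen.mem_nhds ht] with s hs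
    rw [← hprol s hs]
  have h3 := HasFDerivAt.comp t (hasFDerivAt_fderiv_dirV hL p i A) h1
  rw [h2.fderiv_eq]
  refine (DFunLike.congr_fun h3.fderiv (Pi.single A 1 : Fin k → ℝ)).trans ?_
  have h4 := hψ.eq t ht A
  exact congrArg (fun u : Eu n × FVel n k => fderiv ℝ (momentum (lagInChart L p))
    (extChartAt (IVel n k) p p) u (EuclideanSpace.single i (1 : ℝ)) A) h4

theorem IsIntegralSection.idSumFL (hψ : IsIntegralSection (IVel n k) X U ψ)
    (hL : ContMDiff (IVel n k) 𝓘(ℝ, ℝ) ∞ L) :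
    IsIntegralSection (IUni n k)
      (fun A => pushforward (IVel n k) (IUni n k) (idSumFL L) (X A)) U
      (fun t => KSymplectic.idSumFL L (ψ t)) := by
  refine ⟨hψ.isOpen, hψ.zero_mem, (contMDiff_idSumFL hL).comp_contMDiffOn hψ.smooth,
    fun t ht A => ?_⟩
  have h := mfderiv_comp t ((contMDiff_idSumFL hL).mdifferentiable (by simp) (ψ t))
    ((hψ.smooth.contMDiffAt (hψ.isOpen.mem_nhds ht)).mdifferentiableAt (by simp))
  rw [pushforward_apply _ _ (idSumFL_injective L), ← hψ.eq t ht A]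
  exact DFunLike.congr_fun h _

end IntegralSections

end KSymplectic
end

open KSymplectic in
theorem mainTheorem7 (n k : ℕ) (Q : Type*) [TopologicalSpace Q] [ChartedSpace (Eu n) Q]
    [IsManifold (𝓡 n) ∞ Q]
    (L : Vel n k Q → ℝ) (hL : ContMDiff (IVel n k) 𝓘(ℝ, ℝ) ∞ L) (hreg : IsRegularLagrangian L)
    (X : Fin k → (p : Vel n k Q) → TangentSpace (IVel n k) p)
    (hX : SmoothOn (IVel n k) X Set.univ)
    (hsol : ∀ p, FieldEqAt (IVel n k) (omegaL L) (dFun (IVel n k) (energy L)) X p)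
    (Z : Fin k → (w : Uni n k Q) → TangentSpace (IUni n k) w)
    (hZ : ∀ A, Z A = pushforward (IVel n k) (IUni n k) (idSumFL L) (X A)) :
    -- `Z` is a smooth `k`-vector field along `M_L` that solves the unified equation
    (SmoothOn (IUni n k) Z (ML L) ∧
      (∀ w ∈ ML L,
        FieldEqAt (IUni n k) Omega (dFun (IUni n k) (hamiltonian L)) Z w) ∧
    -- and is tangent to `M_L`
      (∀ w ∈ ML L, ∀ A, IsTangentTo (IUni n k) (ML L) w (Z A w))) ∧
    -- integral sections
    (∀ (U : Set (Fin k → ℝ)) (ψ : (Fin k → ℝ) → Vel n k Q),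
      IsIntegralSection (IVel n k) X U ψ →
        (∀ t ∈ U, ψ t = prolong (fun s => (ψ s).proj) t) ∧
        IsEulerLagrangeSol L U (fun s => (ψ s).proj) ∧
        (∀ t, idSumFL L (ψ t) ∈ ML L ∧ pr1 (idSumFL L (ψ t)) = ψ t ∧
          pr2 (idSumFL L (ψ t)) = legendre L (ψ t)) ∧
        IsIntegralSection (IUni n k) Z U (fun t => idSumFL L (ψ t))) := by
  obtain rfl := funext hZ
  have hlocal := fun p => secondOrder_and_eulerLagrange_of_fieldEq hL hreg p (fun A => X A p)
    (hsol p)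
  refine ⟨⟨smoothOn_pushforward_idSumFL hL hX, fun w hw => ?_, fun w hw A => ?_⟩,
    fun U ψ hψ => ?_⟩
  · rw [← idSumFL_pr1 hw]
    exact fieldEqAt_Omega hL hreg (hsol _)
  · beta_reduce
    rw [← idSumFL_pr1 hw, pushforward_apply _ _ (idSumFL_injective L)]
    exact isTangentTo_ML hL _ _
  · have hprol : ∀ t ∈ U, ψ t = prolong (fun s => (ψ s).proj) t := fun t ht =>
      hψ.eq_prolong (fun p A => by
        refine (mfderiv_proj_vel p (X A p)).trans (((hlocal p).1 A).trans ?_)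
        rw [extChartAt_vel]
        exact tangentCoord_self p.proj _) ht
    exact ⟨hprol, hψ.isEulerLagrangeSol hL (fun p => (hlocal p).2) hprol,
      fun t => ⟨idSumFL_mem_ML L _, rfl, rfl⟩, hψ.idSumFL hL⟩
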